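/- Let $A$ be a real $n\times n$ matrix (for instance a diagonal one), let $\mathcal X$ be the space of $C^\infty$ vector fields on $\mathbb R^n$ vanishing at $0$, put $\mathcal L_A(f)(x)=Df(x)Ax-Af(x)$ on $\mathcal X$, $V_I=\operatorname{Im}\mathcal L_A$ and $V_K=\operatorname{Ker}\mathcal L_A$. For $h\in\mathcal X$ write $K=\mathcal P_K(h)$ and $F=\mathcal Q\mathcal P_I(h)$ if $h=\mathcal L_A(F)+K$ with $F\in V_I$ and $K\in V_K$ (such $F$ and $K$ exist and are unique for all $h$ if $\mathcal X=V_I\oplus V_K$; in general any such pair may be chosen, if there is one). Let $g_1,g_2,\dots\in\mathcal X$ and consider $$\dot x=f(x,\varepsilon)= Ax+\varepsilon g_1(x)+\varepsilon^2g_2(x)+\cdots,\qquad(1)$$ where $f$ is $C^\infty$ on an open neighbourhood $U$ of $\mathbb R^n\times\{0\}$ in $\mathbb R^n\times\mathbb R$ and the right-hand side is its Taylor expansion in $\varepsilon$ at $\varepsilon=0$. Let $G_k(x_0,\dots,x_{k-1})$ be the coefficient of $\varepsilon^k$ in the formal expansion of $\sum_{i\ge1}\varepsilon^i g_i\bigl(\sum_{j\ge0}\varepsilon^jx_j\bigr)$,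 and define recursively $R_1=g_1$ and, for $k\ge2$, $$R_k(y)=G_k\bigl(y,\mathcal Q\mathcal P_I(R_1)(y),\dots,\mathcal Q\mathcal P_I(R_{k-1})(y)\bigr)-\sum_{j=1}^{k-1}D\bigl[\mathcal Q\mathcal P_I(R_j)\bigr](y)\,\mathcal P_K(R_{k-j})(y).$$ (a) If $\mathcal X=V_I\oplus V_K$, this recursion determines unique fields $\mathcal Q\mathcal P_I(R_k)$, $\mathcal P_K(R_k)$ for all $k\ge1$. (b) Let $m\ge0$ and let $F_k=\mathcal Q\mathcal P_I(R_k)$, $K_k=\mathcal P_K(R_k)$ satisfy the recursion for $1\le k\le m$. Put $\Phi_\varepsilon(z)=z+\sum_{k=1}^m\varepsilon^kF_k(z)$ (the $m$-th order near identity transformation), $N_\varepsilon(z)=Az+\sum_{k=1}^m\varepsilon^kK_k(z)$, and let $W$ be the set of all $(z,\varepsilon)$ with $(\Phi_\varepsilon(z),\varepsilon)\in U$ and $D\Phi_\varepsilon(z)$ invertible. Then $W$ is open; for every compact $C\subset\mathbb R^n$ there is $\varepsilon_0>0$ such that for $|\varepsilon|<\varepsilon_0$ one has $C\times\{\varepsilon\}\subset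 W$ and $\Phi_\varepsilon$ is injective on $C$; and there is a $C^\infty$ function $S(z,\varepsilon)$ on $W$ such that $x=\Phi_\varepsilon(z)$ transforms (1) into $$\dot z=Az+\varepsilon\mathcal P_K(R_1)(z)+\cdots+\varepsilon^m\mathcal P_K(R_m)(z)+\varepsilon^{m+1}S(z,\varepsilon)\qquad(2)$$ on $W$; that is, $D\Phi_\varepsilon(z)\bigl(N_\varepsilon(z)+\varepsilon^{m+1}S(z,\varepsilon)\bigr)=f(\Phi_\varepsilon(z),\varepsilon)$ for $(z,\varepsilon)\in W$, and a curve $z(\cdot)$ that is differentiable at $t$, with $(z(t),\varepsilon)\in W$, satisfies (2) at $t$ if and only if $x(\cdot)=\Phi_\varepsilon(z(\cdot))$ satisfies (1) at $t$. (c) The truncated system $\dot z=N_\varepsilon(z)$, called the $m$-th order ($C^\infty$) normal form, is invariant under the one-parameter group $z\mapsto e^{As}z$: $N_\varepsilon(e^{As}z)=e^{As}N_\varepsilon(z)$ for all $z\in\mathbb R^n$ and $s,\varepsilon\in\mathbb R$. -/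

import Mathlib

open scoped ContDiff Matrix

namespace SmoothNormalForm

/-- The space of `C^∞` vector fields on `ℝⁿ` that vanish at the origin. -/
def smoothFields (n : ℕ) : Submodule ℝ ((Fin n → ℝ) → (Fin n → ℝ)) where
  carrier := {f | ContDiff ℝ ∞ f ∧ f 0 = 0}
  add_mem' := by
    rintro a b ⟨ha, ha0⟩ ⟨hb, hb0⟩
    exact ⟨ha.add hb, by simp [ha0, hb0]⟩
  zero_mem' := ⟨contDiff_const, rfl⟩
  smul_mem' := by
    rintro c a ⟨ha, ha0⟩
    exact ⟨ha.const_smul c, by simp [ha0]⟩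

theorem lieOp_mem {n : ℕ} (A : Matrix (Fin n) (Fin n) ℝ) (f : smoothFields n) :
    (fun x => fderiv ℝ f.1 x (A *ᵥ x) - A *ᵥ f.1 x) ∈ smoothFields n := by
  obtain ⟨f, hf, hf0⟩ := f
  have hA : ContDiff ℝ ∞ (fun x : Fin n → ℝ => A *ᵥ x) :=
    (LinearMap.toContinuousLinearMap A.mulVecLin).contDiff
  refine ⟨?_, ?_⟩
  · have h1 : ContDiff ℝ ∞ (fderiv ℝ f) := hf.fderiv_right (by simp)
    exact (h1.clm_apply hA).sub (hA.comp hf)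
  · simp [hf0]

/-- The operator `L_A(f)(x) = Df(x) A x - A f(x)` on smooth vector fields vanishing at `0`. -/
noncomputable def lieOp {n : ℕ} (A : Matrix (Fin n) (Fin n) ℝ) : smoothFields n →ₗ[ℝ] smoothFields n where
  toFun f := ⟨fun x => fderiv ℝ f.1 x (A *ᵥ x) - A *ᵥ f.1 x, lieOp_mem A f⟩
  map_add' := by
    rintro ⟨f, hf, hf0⟩ ⟨g, hg, hg0⟩
    ext x : 2
    have h1 : DifferentiableAt ℝ f x := hf.differentiable (by simp) x
    have h2 : DifferentiableAt ℝ g x := hg.differentiable (by simp) x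
    simp only [Submodule.coe_add, Pi.add_apply, AddMemClass.mk_add_mk, fderiv_add h1 h2,
      add_apply, Matrix.mulVec_add]
    abel
  map_smul' := by
    rintro c ⟨f, hf, hf0⟩
    ext x : 2
    have h1 : DifferentiableAt ℝ f x := hf.differentiable (by simp) x
    simp only [SetLike.mk_smul_mk, Pi.smul_apply, fderiv_const_smul h1,
      smul_apply, Matrix.mulVec_smul, RingHom.id_apply, Submodule.coe_smul,
      smul_sub]

/-- `V_I`, the image of `L_A`. -/
noncomputable def VI {n : ℕ} (A : Matrix (Fin n) (Fin n) ℝ) : Submodule ℝ (smoothFields n) :=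
  LinearMap.range (lieOp A)

/-- `V_K`, the kernel of `L_A`. -/
noncomputable def VK {n : ℕ} (A : Matrix (Fin n) (Fin n) ℝ) : Submodule ℝ (smoothFields n) :=
  LinearMap.ker (lieOp A)

/-- `K = P_K(h)` and `F = Q P_I(h)`: the field `h` is the sum of `K ∈ V_K` and of `L_A(F) ∈ V_I`,
where the solution `F` of the homological equation `L_A(F) = P_I(h)` is itself taken in `V_I`. -/
def IsSplitting {n : ℕ} (A : Matrix (Fin n) (Fin n) ℝ) (h : (Fin n → ℝ) → (Fin n → ℝ))
    (F K : smoothFields n) : Prop :=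
  K ∈ VK A ∧ F ∈ VI A ∧ ∀ x, h x = (lieOp A F).1 x + K.1 x

/-- `G_k(x_0, …, x_{k-1})`, the coefficient of `ε^k` in `∑_{i ≥ 1} ε^i g_i(∑_{j ≥ 0} ε^j x_j)`.
Only the terms with `i ≤ k` and `j < k` contribute to that coefficient. -/
noncomputable def coeffG {n : ℕ} (g : ℕ → smoothFields n) (k : ℕ) (x : ℕ → (Fin n → ℝ)) :
    Fin n → ℝ :=
  (k.factorial : ℝ)⁻¹ • iteratedDeriv k
    (fun ε : ℝ => ∑ i ∈ Finset.Icc 1 k, ε ^ i • (g i).1 (∑ j ∈ Finset.range k, ε ^ j • x j)) 0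

/-- `R_k`, in terms of `F_j = Q P_I(R_j)` and `K_j = P_K(R_j)` for `1 ≤ j < k`:
`R_k(y) = G_k(y, F_1(y), …, F_{k-1}(y)) - ∑_{j=1}^{k-1} DF_j(y) K_{k-j}(y)`.
For `k = 1` this is `g_1(y)`. -/
noncomputable def fieldR {n : ℕ} (g F K : ℕ → smoothFields n) (k : ℕ) (y : Fin n → ℝ) :
    Fin n → ℝ :=
  coeffG g k (fun j => if j = 0 then y else (F j).1 y)
    - ∑ j ∈ Finset.Icc 1 (k - 1), fderiv ℝ (F j).1 y ((K (k - j)).1 y)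

/-- The recursion up to order `m`: `F_k = Q P_I(R_k)` and `K_k = P_K(R_k)` for `1 ≤ k ≤ m`.
The entries of index `0` play no role. -/
def IsRecursion {n : ℕ} (A : Matrix (Fin n) (Fin n) ℝ) (g F K : ℕ → smoothFields n)
    (m : ℕ) : Prop :=
  ∀ k, 1 ≤ k → k ≤ m → IsSplitting A (fieldR g F K k) (F k) (K k)

/-- `f(x, ε)` is the right-hand side of `x' = A x + ε g_1(x) + ε² g_2(x) + ⋯`: a `C^∞` function on
an open neighbourhood `U` of `ℝⁿ × {0}` with this Taylor expansion in `ε` at `ε = 0`. -/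
structure IsSystem {n : ℕ} (A : Matrix (Fin n) (Fin n) ℝ) (g : ℕ → smoothFields n)
    (U : Set ((Fin n → ℝ) × ℝ)) (f : (Fin n → ℝ) × ℝ → (Fin n → ℝ)) : Prop where
  isOpen : IsOpen U
  mem : ∀ x, (x, (0 : ℝ)) ∈ U
  contDiffOn : ContDiffOn ℝ ∞ f U
  apply_zero : ∀ x, f (x, 0) = A *ᵥ x
  expansion : ∀ x k, 1 ≤ k →
    iteratedDeriv k (fun ε : ℝ => f (x, ε)) 0 = (k.factorial : ℝ) • (g k).1 x

/-- The `m`-th order near identity transformation `z ↦ z + ∑_{k=1}^m ε^k F_k(z)`. -/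
noncomputable def nearId {n : ℕ} (F : ℕ → smoothFields n) (m : ℕ) (ε : ℝ) (z : Fin n → ℝ) :
    Fin n → ℝ :=
  z + ∑ k ∈ Finset.Icc 1 m, ε ^ k • (F k).1 z

/-- The `m`-th order normal form `A z + ∑_{k=1}^m ε^k K_k(z)`. -/
noncomputable def normalForm {n : ℕ} (A : Matrix (Fin n) (Fin n) ℝ) (K : ℕ → smoothFields n)
    (m : ℕ) (ε : ℝ) (z : Fin n → ℝ) : Fin n → ℝ :=
  A *ᵥ z + ∑ k ∈ Finset.Icc 1 m, ε ^ k • (K k).1 z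

/-- The set of all `(z, ε)` at which the near identity transformation takes its value where the
system is defined and has an invertible derivative in `z`. -/
def regularDomain {n : ℕ} (U : Set ((Fin n → ℝ) × ℝ)) (F : ℕ → smoothFields n) (m : ℕ) :
    Set ((Fin n → ℝ) × ℝ) :=
  {p | (nearId F m p.2 p.1, p.2) ∈ U ∧ (fderiv ℝ (nearId F m p.2) p.1).IsInvertible}

end SmoothNormalForm

open SmoothNormalForm

-- Write Φ for the near identity map and N for the normal form. In the defect f(Φ, ε) - DΦ·N the
-- terms of order 0 cancel, and for 1 ≤ k ≤ m the coefficient of ε^k is R_k - L_A(F_k) - K_k, which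
-- the recursion makes zero. So for each fixed z the defect is o(ε^m) (`defect_isLittleO`). As it is
-- jointly smooth, this pointwise estimate suffices to divide it smoothly by ε^(m+1)
-- (`ContDiffOn.exists_eq_pow_smul`, an iterated Hadamard lemma); applying (DΦ)⁻¹ to the quotient
-- gives S (`IsRecursion.exists_remainder`).
--
-- The recursion is solvable because R_k involves only F_j and K_j with 1 ≤ j < k (`fieldR_congr`),
-- and each step is a splitting along V_I ⊕ V_K (`exists_isSplitting`, `IsSplitting.unique`). The
-- symmetry holds because K ∈ V_K makes K, evaluated along the linear flow, a solution of u' = A u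
-- (`VK.apply_exp_smul_mulVec`).

universe u

section Preliminaries

open Filter Topology Asymptotics

/-! ### Smooth division by powers of ε. -/

theorem contDiff_intervalIntegral_of_contDiff {X E : Type u}
    [NormedAddCommGroup X] [NormedSpace ℝ X] [FiniteDimensional ℝ X]
    [NormedAddCommGroup E] [NormedSpace ℝ E] {a b : ℝ} {f : X × ℝ → E}
    (hf : ContDiff ℝ ∞ f) : ContDiff ℝ ∞ (fun x => ∫ t in a..b, f (x, t)) := by
  have : ProperSpace X := FiniteDimensional.proper ℝ X
  -- The target space varies in the induction, since the derivative has values in `X →L[ℝ] E`; this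
  -- is why `X` and `E` share a universe.
  suffices H : ∀ k : ℕ, ∀ (E : Type u) [NormedAddCommGroup E] [NormedSpace ℝ E] (f : X × ℝ → E),
      ContDiff ℝ ∞ f → ContDiff ℝ k (fun x => ∫ t in a..b, f (x, t)) from
    contDiff_infty.2 fun k => H k E f hf
  intro k
  induction k with
  | zero =>
    intro E _ _ f hf
    rw [Nat.cast_zero, contDiff_zero]
    exact intervalIntegral.continuous_parametric_intervalIntegral_of_continuous'
      (f := fun x t => f (x, t)) hf.continuous a b
  | succ k ih =>
    intro E _ _ f hf
    set f' : X × ℝ → X →L[ℝ] E := fun p => (fderiv ℝ f p).comp (ContinuousLinearMap.inl ℝ X ℝ)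
      with hf'
    have hf's : ContDiff ℝ ∞ f' := (hf.fderiv_right (by simp)).clm_comp contDiff_const
    have hd : ∀ x t, HasFDerivAt (fun y => f (y, t)) (f' (x, t)) x := fun x t =>
      ((hf.differentiable (by simp)) (x, t)).hasFDerivAt.comp x (hasFDerivAt_prodMk_left x t)
    have key : ∀ x, HasFDerivAt (fun x => ∫ t in a..b, f (x, t)) (∫ t in a..b, f' (x, t)) x := by
      intro x
      obtain ⟨C, hC⟩ := ((isCompact_closedBall x 1).prod
        (isCompact_uIcc (a := a) (b := b))).exists_bound_of_continuousOn
          hf's.continuous.continuousOn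
      refine (intervalIntegral.hasFDerivAt_integral_of_dominated_of_fderiv_le
        (F := fun y t => f (y, t)) (F' := fun y t => f' (y, t)) (bound := fun _ => C)
        (Metric.ball_mem_nhds x one_pos) ?_ ?_ ?_ ?_ ?_ ?_)
      · exact .of_forall fun y =>
          (hf.continuous.comp (by fun_prop : Continuous fun t : ℝ => (y, t))).aestronglyMeasurable
      · exact (hf.continuous.comp
          (by fun_prop : Continuous fun t : ℝ => (x, t))).intervalIntegrable _ _
      · exact (hf's.continuous.comp
          (by fun_prop : Continuous fun t : ℝ => (x, t))).aestronglyMeasurable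
      · exact .of_forall fun t ht y hy =>
          hC (y, t) ⟨Metric.ball_subset_closedBall hy, Set.uIoc_subset_uIcc ht⟩
      · exact intervalIntegrable_const
      · exact .of_forall fun t _ y _ => hd y t
    rw [Nat.cast_succ, contDiff_succ_iff_hasFDerivAt]
    exact ⟨fun x => ∫ t in a..b, f' (x, t), ih _ f' hf's, key⟩

section Hadamard

variable {X E : Type u} [NormedAddCommGroup X] [NormedSpace ℝ X] [FiniteDimensional ℝ X]
  [NormedAddCommGroup E] [NormedSpace ℝ E] [CompleteSpace E]

/-- By the fundamental theorem of calculus along t ↦ (x, tε), the quotient is q(x, ε) = ∫₀¹ ∂_ε f(x,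
tε) dt. -/
theorem ContDiff.exists_eq_add_smul {f : X × ℝ → E} (hf : ContDiff ℝ ∞ f) :
    ∃ q : X × ℝ → E, ContDiff ℝ ∞ q ∧ ∀ x ε, f (x, ε) = f (x, 0) + ε • q (x, ε) := by
  set f' : X × ℝ → E := fun p => fderiv ℝ f p (0, 1) with hf'
  have hf's : ContDiff ℝ ∞ f' := (hf.fderiv_right (by simp)).clm_apply contDiff_const
  refine ⟨fun p => ∫ t in (0 : ℝ)..1, f' (p.1, t * p.2), ?_, fun x ε => ?_⟩
  -- `ULift` moves the parameter ε into the universe of `X`.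
  · have := contDiff_intervalIntegral_of_contDiff (X := ULift.{u} ℝ × X) (a := 0) (b := 1)
      (f := fun q => f' (q.1.2, q.2 * q.1.1.down))
      (hf's.comp (by
        have : ContDiff ℝ ∞ (fun q : ULift.{u} ℝ => q.down) :=
          (ContinuousLinearEquiv.ulift (R₁ := ℝ) (M₁ := ℝ)).contDiff
        fun_prop))
    have h2 : ContDiff ℝ ∞ (fun q : ℝ => ULift.up.{u} q) :=
          (ContinuousLinearEquiv.ulift (R₁ := ℝ) (M₁ := ℝ)).symm.contDiff
    exact this.comp (g := fun q : ULift.{u} ℝ × X => ∫ t in (0 : ℝ)..1, f' (q.2, t * q.1.down))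
      (f := fun p : X × ℝ => (ULift.up.{u} p.2, p.1)) (by fun_prop)
  · have hd : ∀ t : ℝ, HasDerivAt (fun t : ℝ => f (x, t * ε)) (ε • f' (x, t * ε)) t := by
      intro t
      have h1 : HasDerivAt (fun t : ℝ => (x, t * ε)) ((0 : X), ε) t := by
        simpa using (hasDerivAt_const t x).prodMk ((hasDerivAt_id t).mul_const ε)
      have h2 := ((hf.differentiable (by simp)) (x, t * ε)).hasFDerivAt.comp_hasDerivAt t h1
      have h3 : ((0 : X), ε) = ε • ((0 : X), (1 : ℝ)) := by simp
      rw [h3, map_smul] at h2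
      exact h2
    have h := intervalIntegral.integral_eq_sub_of_hasDerivAt (a := 0) (b := 1)
      (fun t _ => hd t) (((hf's.continuous.comp (by fun_prop :
        Continuous fun t : ℝ => (x, t * ε))).const_smul ε).intervalIntegrable _ _)
    rw [intervalIntegral.integral_smul] at h
    simp only [one_mul, zero_mul] at h
    rw [h]; abel

/-- The segment from (x, 0) to (x, ε) may leave W, so the integral formula is not available on all
of W. Away from ε = 0 one simply divides; near a point with ε = 0, a bump function extends f to a
global smooth function, whose Hadamard quotient agrees locally with the one defined here. -/
theorem ContDiffOn.exists_eq_smul {W : Set (X × ℝ)} (hW : IsOpen W) {f : X × ℝ → E}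
    (hf : ContDiffOn ℝ ∞ f W) (h0 : ∀ x, (x, (0 : ℝ)) ∈ W → f (x, 0) = 0) :
    ∃ q : X × ℝ → E, ContDiffOn ℝ ∞ q W ∧ ∀ p ∈ W, f p = p.2 • q p := by
  classical
  refine ⟨fun p => if p.2 = 0 then deriv (fun ε => f (p.1, ε)) 0 else p.2⁻¹ • f p, ?_, ?_⟩
  · rintro ⟨x, ε⟩ hp
    apply ContDiffAt.contDiffWithinAt
    by_cases hε : ε = 0
    · subst hε
      obtain ⟨χ, hχs⟩ : ∃ χ : ContDiffBump (x, (0 : ℝ)), tsupport χ ⊆ W := by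
        obtain ⟨r, hr, hrW⟩ := Metric.nhds_basis_closedBall.mem_iff.1 (hW.mem_nhds hp)
        refine ⟨⟨r / 2, r, by positivity, by linarith⟩, ?_⟩
        rw [ContDiffBump.tsupport_eq]
        exact hrW
      have hG : ContDiff ℝ ∞ (fun p => χ p • f p) := by
        rw [contDiff_iff_contDiffAt]
        intro p
        by_cases hpW : p ∈ tsupport χ
        · exact χ.contDiff.contDiffAt.smul ((hf p (hχs hpW)).contDiffAt (hW.mem_nhds (hχs hpW)))
        · have : (fun p => χ p • f p) =ᶠ[𝓝 p] fun _ => 0 := by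
            filter_upwards [notMem_tsupport_iff_eventuallyEq.1 hpW] with y hy
            simp [hy]
          exact contDiffAt_const.congr_of_eventuallyEq this
      obtain ⟨q, hq, hqe⟩ := hG.exists_eq_add_smul
      refine hq.contDiffAt.congr_of_eventuallyEq ?_
      have h1 : ∀ᶠ p in 𝓝 (x, (0 : ℝ)), χ p = 1 ∧ p ∈ W :=
        χ.eventuallyEq_one.and (hW.mem_nhds hp)
      rw [nhds_prod_eq] at h1 ⊢
      obtain ⟨pa, hpa, pb, hpb, hab⟩ := eventually_prod_iff.1 h1
      filter_upwards [prod_mem_prod hpa hpb] with ⟨y, δ⟩ ⟨hy, hδ⟩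
      have e0 : f (y, 0) = 0 := h0 y (hab hy hpb.self_of_nhds).2
      have e1 : ∀ δ, pb δ → f (y, δ) = δ • q (y, δ) := by
        intro δ hδ
        have := hqe y δ
        simpa [e0, (hab hy hδ).1] using this
      by_cases hδ0 : δ = 0
      · subst hδ0
        simp only [if_true]
        have h2 : HasDerivAt (fun δ : ℝ => δ • q (y, δ)) (q (y, 0)) 0 := by
          have h3 : DifferentiableAt ℝ (fun δ : ℝ => q (y, δ)) 0 :=
            ((hq.differentiable (by simp)).comp
              (by fun_prop : Differentiable ℝ fun δ : ℝ => (y, δ))) 0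
          have h4 := (hasDerivAt_id' (0 : ℝ)).smul h3.hasDerivAt
          rw [zero_smul, zero_add, one_smul] at h4
          exact h4
        have h4 : (fun δ => f (y, δ)) =ᶠ[𝓝 0] fun δ : ℝ => δ • q (y, δ) := by
          filter_upwards [hpb] with δ hδ using e1 δ hδ
        exact (h2.congr_of_eventuallyEq h4).deriv
      · simp only [hδ0, if_false]
        rw [e1 δ hδ, inv_smul_smul₀ hδ0]
    · have h1 : (fun p : X × ℝ => if p.2 = 0 then deriv (fun ε => f (p.1, ε)) 0 else p.2⁻¹ • f p)
          =ᶠ[𝓝 (x, ε)] fun p => p.2⁻¹ • f p := by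
        filter_upwards [continuousAt_snd.eventually_ne (x := (x, ε)) hε] with p hp
        simp [hp]
      exact ((contDiffAt_snd.inv hε).smul
        ((hf _ hp).contDiffAt (hW.mem_nhds hp))).congr_of_eventuallyEq h1
  · rintro ⟨x, ε⟩ hp
    by_cases hε : ε = 0
    · subst hε; simp [h0 x hp]
    · simp [hε]

/-- One factor is removed at a time: each quotient tends to 0 along every slice, hence vanishes at ε
= 0 by continuity and is divisible once more. No uniformity in x is needed. -/
theorem ContDiffOn.exists_eq_pow_smul {W : Set (X × ℝ)} (hW : IsOpen W) (m : ℕ) {f : X × ℝ → E}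
    (hf : ContDiffOn ℝ ∞ f W)
    (h0 : ∀ x, (x, (0 : ℝ)) ∈ W → (fun ε : ℝ => f (x, ε)) =o[𝓝 0] fun ε : ℝ => ε ^ m) :
    ∃ q : X × ℝ → E, ContDiffOn ℝ ∞ q W ∧ ∀ p ∈ W, f p = p.2 ^ (m + 1) • q p := by
  have slice : ∀ {f : X × ℝ → E}, ContDiffOn ℝ ∞ f W → ∀ x, (x, (0 : ℝ)) ∈ W →
      Tendsto (fun ε : ℝ => f (x, ε)) (𝓝[≠] 0) (𝓝 (f (x, 0))) := by
    intro f hf x hx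
    have h1 : ContinuousAt f (x, 0) := hf.continuousOn.continuousAt (hW.mem_nhds hx)
    have h2 : ContinuousAt (fun ε : ℝ => (x, ε)) 0 := by fun_prop
    exact (h1.comp_of_eq h2 rfl).tendsto.mono_left nhdsWithin_le_nhds
  induction m with
  | zero =>
    obtain ⟨q, hq, hqe⟩ := hf.exists_eq_smul hW (fun x hx => by
      have h := h0 x hx
      simp only [pow_zero, isLittleO_one_iff] at h
      exact tendsto_nhds_unique (slice hf x hx) (h.mono_left nhdsWithin_le_nhds))
    exact ⟨q, hq, by simpa using hqe⟩
  | succ m ih =>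
    obtain ⟨s, hs, hse⟩ := ih (fun x hx => (h0 x hx).trans_isBigO (by
      simpa [pow_succ] using (isBigO_refl (fun ε : ℝ => ε ^ m) (𝓝 0)).mul
        ((continuous_id.tendsto (0 : ℝ)).isBigO_one ℝ)))
    obtain ⟨q, hq, hqe⟩ := hs.exists_eq_smul hW (fun x hx => by
      refine tendsto_nhds_unique (slice hs x hx) ?_
      have h1 := ((h0 x hx).mono (nhdsWithin_le_nhds (s := {0}ᶜ)))
      have h2 : (fun ε : ℝ => (ε ^ (m + 1))⁻¹ • f (x, ε)) =o[𝓝[≠] 0]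
          fun ε : ℝ => (ε ^ (m + 1))⁻¹ • ε ^ (m + 1) := (isBigO_refl _ _).smul_isLittleO h1
      have hW' : ∀ᶠ ε in 𝓝[≠] (0 : ℝ), (x, ε) ∈ W :=
        nhdsWithin_le_nhds ((by fun_prop : Continuous fun ε : ℝ => (x, ε)).continuousAt
          (hW.mem_nhds hx))
      have h3 : (fun ε => s (x, ε)) =o[𝓝[≠] 0] fun _ : ℝ => (1 : ℝ) := by
        refine h2.congr' ?_ ?_
        · filter_upwards [hW', self_mem_nhdsWithin] with ε hε hne
          rw [hse _ hε, inv_smul_smul₀ (pow_ne_zero _ hne)]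
        · filter_upwards [self_mem_nhdsWithin] with ε hne
          exact inv_mul_cancel₀ (pow_ne_zero _ hne)
      exact (isLittleO_one_iff ℝ).1 h3)
    exact ⟨q, hq, fun p hp => by rw [hse p hp, hqe p hp, smul_smul, ← pow_succ]⟩

end Hadamard

/-! ### Taylor coefficients at ε = 0. -/

section Taylor

variable {E : Type*} [NormedAddCommGroup E] [NormedSpace ℝ E]

theorem ContDiffAt.taylor_isLittleO_zero {a : ℝ → E} {m : ℕ} (ha : ContDiffAt ℝ m a 0) :
    (fun ε => a ε - ∑ k ∈ Finset.range (m + 1),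
      ε ^ k • ((k.factorial : ℝ)⁻¹ • iteratedDeriv k a 0)) =o[𝓝 0] fun ε : ℝ => ε ^ m := by
  obtain ⟨v, hv, hav⟩ := ha.contDiffOn le_rfl (by simp)
  obtain ⟨r, hr, hrv⟩ := Metric.mem_nhds_iff.1 hv
  have h := taylor_isLittleO (convex_ball (0 : ℝ) r) (Metric.mem_ball_self hr) (hav.mono hrv)
  rw [Metric.isOpen_ball.nhdsWithin_eq (Metric.mem_ball_self hr)] at h
  simp only [sub_zero] at h
  refine h.congr_left fun ε => ?_
  rw [taylor_within_apply]
  congr 1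
  refine Finset.sum_congr rfl fun k _ => ?_
  rw [iteratedDerivWithin_of_isOpen Metric.isOpen_ball (Metric.mem_ball_self hr), sub_zero,
    smul_smul, mul_comm]

theorem pow_smul_isLittleO {m k : ℕ} (h : m < k) {v : ℝ → E}
    (hv : ContinuousAt v 0) : (fun ε : ℝ => ε ^ k • v ε) =o[𝓝 0] fun ε : ℝ => ε ^ m := by
  simpa using (isLittleO_pow_pow (𝕜 := ℝ) h).smul_isBigO (hv.tendsto.isBigO_one ℝ)

/-- Modulo o(ε^(m-1)) the top term drops out, so by induction the lower coefficients vanish; what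
remains, ε^m c_m = o(ε^m), forces c_m = 0. -/
theorem eq_zero_of_sum_pow_smul_isLittleO {c : ℕ → E} {m : ℕ}
    (h : (fun ε : ℝ => ∑ k ∈ Finset.range (m + 1), ε ^ k • c k) =o[𝓝 0] fun ε : ℝ => ε ^ m) :
    ∀ k ≤ m, c k = 0 := by
  have last : ∀ m : ℕ, ((fun ε : ℝ => ε ^ m • c m) =o[𝓝 0] fun ε : ℝ => ε ^ m) → c m = 0 := by
    intro m h
    by_contra hc
    have h2 := (h.def (c := ‖c m‖ / 2) (by positivity)).filter_mono
      (nhdsWithin_le_nhds (s := {0}ᶜ))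
    have h3 : ∀ᶠ ε in 𝓝[≠] (0 : ℝ), False := by
      filter_upwards [h2, self_mem_nhdsWithin] with ε h hne
      have h4 : 0 < ‖ε ^ m‖ := norm_pos_iff.2 (pow_ne_zero m hne)
      have h5 : 0 < ‖c m‖ := norm_pos_iff.2 hc
      rw [norm_smul] at h
      nlinarith [mul_pos h4 h5]
    exact (h3.exists).elim fun _ h => h
  induction m with
  | zero =>
    intro k hk
    obtain rfl : k = 0 := by omega
    exact last 0 (by simpa using h)
  | succ m ih =>
    have h1 : (fun ε : ℝ => ∑ k ∈ Finset.range (m + 1), ε ^ k • c k) =o[𝓝 0]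
        fun ε : ℝ => ε ^ m := by
      have h2 := (h.trans (isLittleO_pow_pow m.lt_succ_self)).sub
        (pow_smul_isLittleO (v := fun _ => c (m + 1)) m.lt_succ_self continuousAt_const)
      refine h2.congr_left fun ε => ?_
      rw [Finset.sum_range_succ _ (m + 1), add_sub_cancel_right]
    have h3 := ih h1
    intro k hk
    rcases Nat.lt_or_ge k (m + 1) with hk' | hk'
    · exact h3 k (by omega)
    · obtain rfl : k = m + 1 := by omega
      refine last _ (h.congr_left fun ε => ?_)
      rw [Finset.sum_range_succ, Finset.sum_eq_zero, zero_add]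
      intro i hi
      rw [h3 i (by simpa [Nat.lt_succ_iff] using hi), smul_zero]

theorem iteratedDeriv_eq_of_sub_isLittleO {a b : ℝ → E} {m : ℕ} (ha : ContDiffAt ℝ m a 0)
    (hb : ContDiffAt ℝ m b 0) (h : (fun ε => a ε - b ε) =o[𝓝 0] fun ε : ℝ => ε ^ m) :
    iteratedDeriv m a 0 = iteratedDeriv m b 0 := by
  have h1 := (h.sub ha.taylor_isLittleO_zero).add hb.taylor_isLittleO_zero
  have h2 := eq_zero_of_sum_pow_smul_isLittleO
    (c := fun k => (k.factorial : ℝ)⁻¹ • (iteratedDeriv k a 0 - iteratedDeriv k b 0)) (m := m)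
    (h1.congr_left fun ε => by simp only [smul_sub, Finset.sum_sub_distrib]; abel) m le_rfl
  have h3 : (m.factorial : ℝ)⁻¹ ≠ 0 := by positivity
  exact sub_eq_zero.1 ((smul_eq_zero.1 h2).resolve_left h3)

/-- Each ε-derivative is a Fréchet derivative in the direction (0, 1). This gives smoothness of G_k
in y. -/
theorem ContDiff.iteratedDeriv_slice {X : Type*} [NormedAddCommGroup X] [NormedSpace ℝ X]
    {q : X × ℝ → E} (hq : ContDiff ℝ ∞ q) (k : ℕ) :
    ContDiff ℝ ∞ (fun p : X × ℝ => iteratedDeriv k (fun ε => q (p.1, ε)) p.2) := by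
  induction k with
  | zero => simpa using hq
  | succ k ih =>
    have h : (fun p : X × ℝ => iteratedDeriv (k + 1) (fun ε => q (p.1, ε)) p.2)
        = fun p => fderiv ℝ (fun p : X × ℝ => iteratedDeriv k (fun ε => q (p.1, ε)) p.2) p
          (0, 1) := by
      ext ⟨x, ε⟩
      rw [iteratedDeriv_succ]
      have h1 : HasDerivAt (fun t : ℝ => (x, t)) ((0 : X), (1 : ℝ)) ε :=
        (hasDerivAt_const ε x).prodMk (hasDerivAt_id ε)
      exact (((ih.differentiable (by simp)) (x, ε)).hasFDerivAt.comp_hasDerivAt ε h1).deriv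
    rw [h]
    exact (ih.fderiv_right (by simp)).clm_apply contDiff_const

end Taylor

theorem sum_Icc_one_eq_sum_range {M : Type*} [AddCommMonoid M] (f : ℕ → M) (m : ℕ) :
    ∑ k ∈ Finset.Icc 1 m, f k = ∑ k ∈ Finset.range m, f (k + 1) := by
  induction m with
  | zero => simp
  | succ m ih => rw [Finset.sum_Icc_succ_top (by omega), ih, Finset.sum_range_succ]

section Products

variable {E : Type*} [NormedAddCommGroup E] [NormedSpace ℝ E]

/-- The pairs with j + l ≤ m, grouped by k = j + l, give exactly the second sum; the others carry a
power above m. -/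
theorem sum_pow_add_smul_sub_isLittleO (m : ℕ) (T : ℕ → ℕ → E) :
    (fun ε : ℝ => (∑ j ∈ Finset.Icc 1 m, ∑ l ∈ Finset.Icc 1 m, ε ^ (j + l) • T j l)
      - ∑ k ∈ Finset.Icc 1 m, ε ^ k • ∑ j ∈ Finset.Icc 1 (k - 1), T j (k - j))
      =o[𝓝 0] fun ε : ℝ => ε ^ m := by
  have h : ∀ ε : ℝ, (∑ k ∈ Finset.Icc 1 m, ε ^ k • ∑ j ∈ Finset.Icc 1 (k - 1), T j (k - j))
      = ∑ p ∈ (Finset.Icc 1 m ×ˢ Finset.Icc 1 m) with p.1 + p.2 ≤ m,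
          ε ^ (p.1 + p.2) • T p.1 p.2 := by
    intro ε
    simp_rw [Finset.smul_sum]
    rw [Finset.sum_sigma']
    refine Finset.sum_nbij' (fun s => (s.2, s.1 - s.2)) (fun p => ⟨p.1 + p.2, p.1⟩) ?_ ?_ ?_ ?_ ?_
    · rintro ⟨k, j⟩ h
      simp only [Finset.mem_sigma, Finset.mem_Icc, Finset.mem_filter, Finset.mem_product] at h ⊢
      omega
    · rintro ⟨i, j⟩ h
      simp only [Finset.mem_sigma, Finset.mem_Icc, Finset.mem_filter, Finset.mem_product] at h ⊢
      omega
    · rintro ⟨k, j⟩ h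
      simp only [Finset.mem_sigma, Finset.mem_Icc] at h
      simp only [Sigma.mk.injEq, heq_eq_eq, and_true]
      omega
    · rintro ⟨i, j⟩ h
      simp
    · rintro ⟨k, j⟩ h
      simp only [Finset.mem_sigma, Finset.mem_Icc] at h
      simp only
      rw [show j + (k - j) = k by omega]
  have h2 : ∀ ε : ℝ, (∑ j ∈ Finset.Icc 1 m, ∑ l ∈ Finset.Icc 1 m, ε ^ (j + l) • T j l)
      - (∑ k ∈ Finset.Icc 1 m, ε ^ k • ∑ j ∈ Finset.Icc 1 (k - 1), T j (k - j))
      = ∑ p ∈ (Finset.Icc 1 m ×ˢ Finset.Icc 1 m) with ¬ (p.1 + p.2 ≤ m),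
          ε ^ (p.1 + p.2) • T p.1 p.2 := by
    intro ε
    rw [h ε, ← Finset.sum_product', ← Finset.sum_filter_add_sum_filter_not _
      (fun p => p.1 + p.2 ≤ m), add_sub_cancel_left]
  simp_rw [h2]
  refine IsLittleO.fun_sum fun p hp => ?_
  exact pow_smul_isLittleO (not_le.1 (Finset.mem_filter.1 hp).2) continuousAt_const

end Products

/-! ### The near identity transformation and the transformed system. -/

namespace SmoothNormalForm

variable {n : ℕ}

theorem contDiff_coe (f : smoothFields n) : ContDiff ℝ ∞ f.1 := f.2.1

theorem contDiff_mulVec (A : Matrix (Fin n) (Fin n) ℝ) :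
    ContDiff ℝ ∞ (fun x : Fin n → ℝ => A *ᵥ x) :=
  (LinearMap.toContinuousLinearMap A.mulVecLin).contDiff

theorem contDiff_sum_pow_smul_comp_sum {X : Type*} [NormedAddCommGroup X] [NormedSpace ℝ X]
    (g : ℕ → smoothFields n) {x : ℕ → X → (Fin n → ℝ)} (hx : ∀ j, ContDiff ℝ ∞ (x j))
    (s t : Finset ℕ) :
    ContDiff ℝ ∞ (fun p : X × ℝ =>
      ∑ i ∈ s, p.2 ^ i • (g i).1 (∑ j ∈ t, p.2 ^ j • x j p.1)) := by
  refine ContDiff.sum fun i _ => (contDiff_snd.pow i).smul ((contDiff_coe (g i)).comp ?_)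
  exact ContDiff.sum fun j _ => (contDiff_snd.pow j).smul ((hx j).comp contDiff_fst)

theorem contDiff_sum_pow_smul_comp_sum_const
    (g : ℕ → smoothFields n) (x : ℕ → (Fin n → ℝ)) (s t : Finset ℕ) :
    ContDiff ℝ ∞ (fun ε : ℝ =>
      ∑ i ∈ s, ε ^ i • (g i).1 (∑ j ∈ t, ε ^ j • x j)) :=
  (contDiff_sum_pow_smul_comp_sum (X := ℝ) g (x := fun j _ => x j) (fun _ => contDiff_const)
    s t).comp (f := fun ε : ℝ => ((0 : ℝ), ε)) (by fun_prop)

/-- The truncation in `coeffG` does not affect the coefficient of ε^k: dropping x_j with j ≥ k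
changes the argument of g_i by O(ε^k), and the factor ε^i with i ≥ 1 makes this o(ε^k). -/
theorem sum_sub_sum_isLittleO (g : ℕ → smoothFields n) (x : ℕ → (Fin n → ℝ)) {k m : ℕ}
    (hkm : k ≤ m) :
    (fun ε : ℝ => (∑ i ∈ Finset.Icc 1 m, ε ^ i • (g i).1 (∑ j ∈ Finset.range (m + 1), ε ^ j • x j))
      - ∑ i ∈ Finset.Icc 1 k, ε ^ i • (g i).1 (∑ j ∈ Finset.range k, ε ^ j • x j))
      =o[𝓝 0] fun ε : ℝ => ε ^ k := by
  -- For k = 0 the shorter inner sum is empty, so it need not tend to `x 0`.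
  rcases Nat.eq_zero_or_pos k with rfl | hk
  · simp only [zero_lt_one, Finset.Icc_eq_empty_of_lt, Finset.sum_empty, sub_zero]
    refine IsLittleO.fun_sum fun i hi => ?_
    refine pow_smul_isLittleO (Finset.mem_Icc.1 hi).1 ?_
    exact ((contDiff_coe (g i)).continuous.comp (by fun_prop)).continuousAt
  have hsplit : ∀ ε : ℝ,
      (∑ i ∈ Finset.Icc 1 m, ε ^ i • (g i).1 (∑ j ∈ Finset.range (m + 1), ε ^ j • x j))
      - ∑ i ∈ Finset.Icc 1 k, ε ^ i • (g i).1 (∑ j ∈ Finset.range k, ε ^ j • x j)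
      = (∑ i ∈ Finset.Icc 1 k, ε ^ i • ((g i).1 (∑ j ∈ Finset.range (m + 1), ε ^ j • x j)
          - (g i).1 (∑ j ∈ Finset.range k, ε ^ j • x j)))
        + ∑ i ∈ Finset.Icc (k + 1) m,
            ε ^ i • (g i).1 (∑ j ∈ Finset.range (m + 1), ε ^ j • x j) := by
    intro ε
    have : Finset.Icc 1 m = Finset.Icc 1 k ∪ Finset.Icc (k + 1) m := by
      ext i; simp only [Finset.mem_union, Finset.mem_Icc]; omega
    rw [this, Finset.sum_union]
    · simp only [smul_sub, Finset.sum_sub_distrib]; abel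
    · rw [Finset.disjoint_left]; intro i; simp only [Finset.mem_Icc]; omega
  simp_rw [hsplit]
  refine (IsLittleO.fun_sum fun i hi => ?_).add (IsLittleO.fun_sum fun i hi => ?_)
  · have hd : (fun ε : ℝ => (∑ j ∈ Finset.range (m + 1), ε ^ j • x j)
        - ∑ j ∈ Finset.range k, ε ^ j • x j) =O[𝓝 0] fun ε : ℝ => ε ^ k := by
      have : ∀ ε : ℝ, (∑ j ∈ Finset.range (m + 1), ε ^ j • x j)
          - ∑ j ∈ Finset.range k, ε ^ j • x j = ∑ j ∈ Finset.Ico k (m + 1), ε ^ j • x j :=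
        fun ε => (Finset.sum_Ico_eq_sub _ (by omega)).symm
      simp_rw [this]
      refine IsBigO.fun_sum fun j hj => ?_
      have h1 : (fun ε : ℝ => ε ^ j) =O[𝓝 0] fun ε : ℝ => ε ^ k :=
        (Finset.mem_Ico.1 hj).1.eq_or_lt.elim (fun h => h ▸ isBigO_refl _ _)
          fun h => (isLittleO_pow_pow h).isBigO
      simpa using h1.smul (isBigO_const_const (x j) (one_ne_zero' ℝ) (𝓝 0))
    have hs := (((contDiff_coe (g i)).contDiffAt (x := x 0)).hasStrictFDerivAt (by simp)).isBigO_sub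
    have ht : Tendsto (fun ε : ℝ => ((∑ j ∈ Finset.range (m + 1), ε ^ j • x j),
        ∑ j ∈ Finset.range k, ε ^ j • x j)) (𝓝 0) (𝓝 (x 0, x 0)) := by
      have hc : Continuous (fun ε : ℝ => ((∑ j ∈ Finset.range (m + 1), ε ^ j • x j),
        ∑ j ∈ Finset.range k, ε ^ j • x j)) := by fun_prop
      convert hc.tendsto 0 using 3
      · rw [Finset.sum_range_succ']; simp
      · obtain ⟨k, rfl⟩ := Nat.exists_eq_succ_of_ne_zero hk.ne'
        rw [Nat.succ_eq_add_one, Finset.sum_range_succ']; simp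
    have h2 := (hs.comp_tendsto ht).trans hd
    have h3 : (fun ε : ℝ => ε ^ i) =o[𝓝 0] fun _ : ℝ => (1 : ℝ) := by
      simpa using isLittleO_pow_pow (𝕜 := ℝ) (m := 0) (Finset.mem_Icc.1 hi).1
    simpa using h3.smul_isBigO h2
  · refine pow_smul_isLittleO (Finset.mem_Icc.1 hi).1 ?_
    exact ((contDiff_coe (g i)).continuous.comp (by fun_prop)).continuousAt

theorem sum_sub_sum_coeffG_isLittleO (g : ℕ → smoothFields n) (x : ℕ → (Fin n → ℝ)) (m : ℕ) :
    (fun ε : ℝ => (∑ i ∈ Finset.Icc 1 m, ε ^ i • (g i).1 (∑ j ∈ Finset.range (m + 1), ε ^ j • x j))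
      - ∑ k ∈ Finset.Icc 1 m, ε ^ k • coeffG g k x) =o[𝓝 0] fun ε : ℝ => ε ^ m := by
  have hs : ∀ (s t : Finset ℕ) (k : ℕ), ContDiffAt ℝ k (fun ε : ℝ =>
      ∑ i ∈ s, ε ^ i • (g i).1 (∑ j ∈ t, ε ^ j • x j)) 0 := fun s t k =>
    ((contDiff_sum_pow_smul_comp_sum_const g x s t).of_le (mod_cast le_top)).contDiffAt
  refine (hs (Finset.Icc 1 m) (Finset.range (m + 1)) m).taylor_isLittleO_zero.congr_left
    fun ε => ?_
  congr 1
  rw [Finset.sum_range_succ', sum_Icc_one_eq_sum_range]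
  have h0 : (∑ i ∈ Finset.Icc 1 m, (0 : ℝ) ^ i •
      (g i).1 (∑ j ∈ Finset.range (m + 1), (0 : ℝ) ^ j • x j)) = 0 :=
    Finset.sum_eq_zero fun i hi => by
      rw [zero_pow (by have := (Finset.mem_Icc.1 hi).1; omega), zero_smul]
  simp only [iteratedDeriv_zero, h0, smul_zero, add_zero]
  refine Finset.sum_congr rfl fun k hk => ?_
  have hk : k + 1 ≤ m := Finset.mem_range.1 hk
  rw [coeffG, iteratedDeriv_eq_of_sub_isLittleO (hs _ _ _) (hs _ _ _)
    (sum_sub_sum_isLittleO g x hk)]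

theorem nearId_eq_sum (F : ℕ → smoothFields n) (m : ℕ) (ε : ℝ) (z : Fin n → ℝ) :
    nearId F m ε z
      = ∑ j ∈ Finset.range (m + 1), ε ^ j • (if j = 0 then z else (F j).1 z) := by
  rw [nearId, Finset.sum_range_succ', sum_Icc_one_eq_sum_range, add_comm]
  simp

theorem contDiff_nearId (F : ℕ → smoothFields n) (m : ℕ) :
    ContDiff ℝ ∞ (fun p : (Fin n → ℝ) × ℝ => nearId F m p.2 p.1) :=
  contDiff_fst.add (ContDiff.sum fun j _ => (contDiff_snd.pow j).smul
    ((contDiff_coe (F j)).comp contDiff_fst))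

theorem contDiff_normalForm (A : Matrix (Fin n) (Fin n) ℝ) (K : ℕ → smoothFields n) (m : ℕ) :
    ContDiff ℝ ∞ (fun p : (Fin n → ℝ) × ℝ => normalForm A K m p.2 p.1) :=
  ((contDiff_mulVec A).comp contDiff_fst).add (ContDiff.sum fun j _ => (contDiff_snd.pow j).smul
    ((contDiff_coe (K j)).comp contDiff_fst))

theorem hasFDerivAt_nearId (F : ℕ → smoothFields n) (m : ℕ) (ε : ℝ) (z : Fin n → ℝ) :
    HasFDerivAt (nearId F m ε) (ContinuousLinearMap.id ℝ (Fin n → ℝ)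
      + ∑ k ∈ Finset.Icc 1 m, ε ^ k • fderiv ℝ (F k).1 z) z :=
  (hasFDerivAt_id z).add (HasFDerivAt.fun_sum fun k _ =>
    (((contDiff_coe (F k)).differentiable (by simp)) z).hasFDerivAt.const_smul (ε ^ k))

theorem contDiff_fderiv_nearId (F : ℕ → smoothFields n) (m : ℕ) :
    ContDiff ℝ ∞ (fun p : (Fin n → ℝ) × ℝ => fderiv ℝ (nearId F m p.2) p.1) := by
  have : (fun p : (Fin n → ℝ) × ℝ => fderiv ℝ (nearId F m p.2) p.1)
      = fun p => ContinuousLinearMap.id ℝ (Fin n → ℝ)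
        + ∑ k ∈ Finset.Icc 1 m, p.2 ^ k • fderiv ℝ (F k).1 p.1 :=
    funext fun p => (hasFDerivAt_nearId F m p.2 p.1).fderiv
  rw [this]
  exact contDiff_const.add (ContDiff.sum fun k _ => (contDiff_snd.pow k).smul
    (((contDiff_coe (F k)).fderiv_right (by simp)).comp contDiff_fst))

theorem nearId_zero (F : ℕ → smoothFields n) (m : ℕ) (z : Fin n → ℝ) : nearId F m 0 z = z := by
  rw [nearId, Finset.sum_eq_zero, add_zero]
  intro k hk
  rw [zero_pow (by have := (Finset.mem_Icc.1 hk).1; omega), zero_smul]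

theorem fderiv_nearId_zero (F : ℕ → smoothFields n) (m : ℕ) (z : Fin n → ℝ) :
    fderiv ℝ (nearId F m 0) z = ContinuousLinearMap.id ℝ (Fin n → ℝ) := by
  rw [(funext (nearId_zero F m) : nearId F m 0 = id), fderiv_id]

theorem isOpen_setOf_isInvertible {V W : Type*} [NormedAddCommGroup V] [NormedSpace ℝ V]
    [CompleteSpace V] [NormedAddCommGroup W] [NormedSpace ℝ W] :
    IsOpen {L : V →L[ℝ] W | L.IsInvertible} := by
  have : {L : V →L[ℝ] W | L.IsInvertible} = Set.range ((↑) : (V ≃L[ℝ] W) → V →L[ℝ] W) := by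
    ext L; rfl
  rw [this]
  exact ContinuousLinearEquiv.isOpen

variable {A : Matrix (Fin n) (Fin n) ℝ} {g F K : ℕ → smoothFields n} {m : ℕ}
  {U : Set ((Fin n → ℝ) × ℝ)} {f : (Fin n → ℝ) × ℝ → (Fin n → ℝ)}

theorem isOpen_regularDomain (hU : IsOpen U) (F : ℕ → smoothFields n) (m : ℕ) :
    IsOpen (regularDomain U F m) :=
  (hU.preimage ((contDiff_nearId F m).continuous.prodMk continuous_snd)).inter
    (isOpen_setOf_isInvertible.preimage (contDiff_fderiv_nearId F m).continuous)

theorem mem_regularDomain_zero (hU : ∀ x, (x, (0 : ℝ)) ∈ U) (F : ℕ → smoothFields n) (m : ℕ)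
    (z : Fin n → ℝ) : (z, (0 : ℝ)) ∈ regularDomain U F m := by
  refine ⟨by simpa only [nearId_zero] using hU z, ?_⟩
  simp only [fderiv_nearId_zero]
  exact ⟨ContinuousLinearEquiv.refl ℝ _, rfl⟩

/-- For small ε the perturbation Φ - id has Lipschitz constant below 1 on C. The constants come from
a closed ball around C, whose convexity allows the mean value inequality. -/
theorem exists_forall_injOn_nearId (F : ℕ → smoothFields n) (m : ℕ) {C : Set (Fin n → ℝ)}
    (hC : IsCompact C) :
    ∃ δ : ℝ, 0 < δ ∧ ∀ ε : ℝ, |ε| < δ → Set.InjOn (nearId F m ε) C := by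
  obtain ⟨r, hr⟩ := hC.isBounded.subset_closedBall (0 : Fin n → ℝ)
  have hL : ∀ k, ∃ L : ℝ, ∀ x ∈ Metric.closedBall (0 : Fin n → ℝ) r,
      ∀ y ∈ Metric.closedBall (0 : Fin n → ℝ) r,
        ‖(F k).1 x - (F k).1 y‖ ≤ L * ‖x - y‖ := by
    intro k
    obtain ⟨L, hL⟩ := (isCompact_closedBall (0 : Fin n → ℝ) r).exists_bound_of_continuousOn
      ((contDiff_coe (F k)).continuous_fderiv (by simp)).continuousOn
    exact ⟨L, fun x hx y hy => (convex_closedBall _ _).norm_image_sub_le_of_norm_fderiv_le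
      (fun z _ => ((contDiff_coe (F k)).differentiable (by simp)) z) hL hy hx⟩
  choose L hL using hL
  have hc : Continuous fun ε : ℝ => ∑ k ∈ Finset.Icc 1 m, |ε| ^ k * L k := by fun_prop
  have h0 : ∀ᶠ ε in 𝓝 (0 : ℝ), ∑ k ∈ Finset.Icc 1 m, |ε| ^ k * L k < 1 := by
    refine hc.continuousAt.eventually_lt continuousAt_const ?_
    rw [Finset.sum_eq_zero]
    · exact one_pos
    · intro k hk
      rw [abs_zero, zero_pow (by have := (Finset.mem_Icc.1 hk).1; omega), zero_mul]
  obtain ⟨δ, hδ, hδ1⟩ := Metric.eventually_nhds_iff.1 h0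
  refine ⟨δ, hδ, fun ε hε x hx y hy hxy => ?_⟩
  have h1 := hδ1 (y := ε) (by simpa using hε)
  by_contra hne
  have h2 : 0 < ‖x - y‖ := norm_pos_iff.2 (sub_ne_zero.2 hne)
  have h3 : x - y = -∑ k ∈ Finset.Icc 1 m, ε ^ k • ((F k).1 x - (F k).1 y) := by
    simp only [nearId] at hxy
    simp only [smul_sub, Finset.sum_sub_distrib]
    rw [neg_sub, sub_eq_sub_iff_add_eq_add, hxy, add_comm]
  have h4 : ‖x - y‖ ≤ (∑ k ∈ Finset.Icc 1 m, |ε| ^ k * L k) * ‖x - y‖ := by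
    conv_lhs => rw [h3, norm_neg]
    rw [Finset.sum_mul]
    refine (norm_sum_le _ _).trans (Finset.sum_le_sum fun k _ => ?_)
    rw [norm_smul, norm_pow, Real.norm_eq_abs, mul_assoc]
    exact mul_le_mul_of_nonneg_left (hL k x (hr hx) y (hr hy)) (by positivity)
  nlinarith

theorem exists_forall_mem_regularDomain_and_injOn (hU : IsOpen U) (hU0 : ∀ x, (x, (0 : ℝ)) ∈ U)
    (F : ℕ → smoothFields n) (m : ℕ) {C : Set (Fin n → ℝ)} (hC : IsCompact C) :
    ∃ ε₀ : ℝ, 0 < ε₀ ∧ ∀ ε : ℝ, |ε| < ε₀ →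
      (∀ z ∈ C, (z, ε) ∈ regularDomain U F m) ∧ Set.InjOn (nearId F m ε) C := by
  obtain ⟨δ, hδ, hinj⟩ := exists_forall_injOn_nearId F m hC
  -- The open regular domain contains C × {0}, hence a product neighbourhood of it.
  obtain ⟨u, v, -, hv, hCu, h0v, huv⟩ := generalized_tube_lemma hC
    (isCompact_singleton (x := (0 : ℝ))) (isOpen_regularDomain hU F m) (by
      rintro ⟨z, ε⟩ ⟨-, rfl⟩
      exact mem_regularDomain_zero hU0 F m z)
  obtain ⟨r, hr, hrv⟩ := Metric.isOpen_iff.1 hv 0 (h0v rfl)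
  refine ⟨min δ r, lt_min hδ hr, fun ε hε => ⟨fun z hz => huv ⟨hCu hz, hrv ?_⟩, hinj ε ?_⟩⟩
  · simpa using hε.trans_le (min_le_right _ _)
  · exact hε.trans_le (min_le_left _ _)

theorem IsSystem.exists_eq_add_pow_smul (hf : IsSystem A g U f) (m : ℕ) :
    ∃ r : (Fin n → ℝ) × ℝ → (Fin n → ℝ), ContDiffOn ℝ ∞ r U ∧ ∀ p ∈ U,
      f p = A *ᵥ p.1 + ∑ i ∈ Finset.Icc 1 m, p.2 ^ i • (g i).1 p.1 + p.2 ^ (m + 1) • r p := by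
  have hs : ContDiff ℝ ∞ (fun p : (Fin n → ℝ) × ℝ =>
      A *ᵥ p.1 + ∑ i ∈ Finset.Icc 1 m, p.2 ^ i • (g i).1 p.1) := contDiff_normalForm A g m
  obtain ⟨r, hr, hre⟩ := (hf.contDiffOn.sub hs.contDiffOn).exists_eq_pow_smul hf.isOpen m (by
    intro x hx
    have h1 : ContDiffAt ℝ m (fun ε : ℝ => f (x, ε)) 0 :=
      ((hf.contDiffOn.contDiffAt (hf.isOpen.mem_nhds hx)).of_le (mod_cast le_top)).comp (0 : ℝ)
        (contDiffAt_const.prodMk contDiffAt_id)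
    refine h1.taylor_isLittleO_zero.congr_left fun ε => ?_
    congr 1
    rw [Finset.sum_range_succ', sum_Icc_one_eq_sum_range, add_comm]
    congr 1
    · simp [hf.apply_zero]
    · refine Finset.sum_congr rfl fun k _ => ?_
      rw [hf.expansion x (k + 1) (by omega), inv_smul_smul₀ (by positivity)])
  exact ⟨r, hr, fun p hp => by rw [← hre p hp, add_sub_cancel]⟩

/-- The coefficient of ε^k is A F_k + G_k - DF_k A z - K_k - ∑ DF_j K_{k-j}, which is the
homological equation for R_k with all terms on one side. -/
theorem defect_isLittleO (hrec : IsRecursion A g F K m) (hf : IsSystem A g U f)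
    (z : Fin n → ℝ) :
    (fun ε : ℝ => f (nearId F m ε z, ε) - fderiv ℝ (nearId F m ε) z (normalForm A K m ε z))
      =o[𝓝 0] fun ε : ℝ => ε ^ m := by
  obtain ⟨r, hr, hre⟩ := hf.exists_eq_add_pow_smul m
  set x : ℕ → (Fin n → ℝ) := fun j => if j = 0 then z else (F j).1 z with hx
  have hc : ContinuousAt (fun ε : ℝ => (nearId F m ε z, ε)) 0 :=
    ((contDiff_nearId F m).continuous.comp
      (by fun_prop : Continuous fun ε : ℝ => (z, ε))).continuousAt.prodMk continuousAt_id
  have hz : (nearId F m 0 z, (0 : ℝ)) ∈ U := hf.mem _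
  have h1 : (fun ε : ℝ => ε ^ (m + 1) • r (nearId F m ε z, ε)) =o[𝓝 0] fun ε : ℝ => ε ^ m :=
    pow_smul_isLittleO m.lt_succ_self (ContinuousAt.comp (f := fun ε : ℝ => (nearId F m ε z, ε))
      (hr.continuousOn.continuousAt (hf.isOpen.mem_nhds hz)) hc)
  have h2 := sum_sub_sum_coeffG_isLittleO g x m
  have h3 := sum_pow_add_smul_sub_isLittleO m
    (fun j l => fderiv ℝ (F j).1 z ((K l).1 z))
  refine ((h2.add h1).sub h3).congr' ?_ EventuallyEq.rfl
  filter_upwards [hc (hf.isOpen.mem_nhds hz)] with ε hε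
  rw [hre _ hε, (hasFDerivAt_nearId F m ε z).fderiv]
  simp only [hx, ← nearId_eq_sum]
  have h4 : A *ᵥ nearId F m ε z = A *ᵥ z + ∑ k ∈ Finset.Icc 1 m, ε ^ k • (A *ᵥ (F k).1 z) := by
    rw [nearId, Matrix.mulVec_add, Matrix.mulVec_sum]
    simp only [Matrix.mulVec_smul]
  -- The recursion, solved for G_k.
  have h5 : ∑ k ∈ Finset.Icc 1 m, ε ^ k • coeffG g k x
      = (∑ k ∈ Finset.Icc 1 m, ε ^ k • fderiv ℝ (F k).1 z (A *ᵥ z))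
        - (∑ k ∈ Finset.Icc 1 m, ε ^ k • (A *ᵥ (F k).1 z))
        + (∑ k ∈ Finset.Icc 1 m, ε ^ k • (K k).1 z)
        + ∑ k ∈ Finset.Icc 1 m, ε ^ k •
          ∑ j ∈ Finset.Icc 1 (k - 1), fderiv ℝ (F j).1 z ((K (k - j)).1 z) := by
    rw [← Finset.sum_sub_distrib, ← Finset.sum_add_distrib, ← Finset.sum_add_distrib]
    refine Finset.sum_congr rfl fun k hk => ?_
    rw [← smul_sub, ← smul_add, ← smul_add]
    congr 1
    have h6 := (hrec k (Finset.mem_Icc.1 hk).1 (Finset.mem_Icc.1 hk).2).2.2 z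
    rw [fieldR, sub_eq_iff_eq_add] at h6
    exact h6
  have h7 : (ContinuousLinearMap.id ℝ (Fin n → ℝ)
      + ∑ k ∈ Finset.Icc 1 m, ε ^ k • fderiv ℝ (F k).1 z) (normalForm A K m ε z)
      = A *ᵥ z + (∑ k ∈ Finset.Icc 1 m, ε ^ k • (K k).1 z)
        + (∑ k ∈ Finset.Icc 1 m, ε ^ k • fderiv ℝ (F k).1 z (A *ᵥ z))
        + ∑ j ∈ Finset.Icc 1 m, ∑ l ∈ Finset.Icc 1 m,
          ε ^ (j + l) • fderiv ℝ (F j).1 z ((K l).1 z) := by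
    rw [Finset.sum_comm]
    simp only [normalForm, add_apply, ContinuousLinearMap.id_apply, sum_apply, smul_apply,
      map_add, map_sum, map_smul, smul_add, Finset.smul_sum, smul_smul, pow_add,
      mul_comm, Finset.sum_add_distrib]
    abel
  rw [h7, h4, h5]
  abel

theorem IsRecursion.exists_remainder (hrec : IsRecursion A g F K m) (hf : IsSystem A g U f) :
    ∃ S : (Fin n → ℝ) × ℝ → (Fin n → ℝ), ContDiffOn ℝ ∞ S (regularDomain U F m) ∧
      ∀ (z : Fin n → ℝ) (ε : ℝ), (z, ε) ∈ regularDomain U F m →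
        fderiv ℝ (nearId F m ε) z (normalForm A K m ε z + ε ^ (m + 1) • S (z, ε))
          = f (nearId F m ε z, ε) := by
  have hW := isOpen_regularDomain hf.isOpen F m
  have hfΦ : ContDiffOn ℝ ∞ (fun p : (Fin n → ℝ) × ℝ => f (nearId F m p.2 p.1, p.2))
      (regularDomain U F m) :=
    hf.contDiffOn.comp ((contDiff_nearId F m).prodMk contDiff_snd).contDiffOn fun p hp => hp.1
  obtain ⟨T, hT, hTe⟩ := (hfΦ.sub ((contDiff_fderiv_nearId F m).clm_apply
    (contDiff_normalForm A K m)).contDiffOn).exists_eq_pow_smul hW m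
      (fun z _ => defect_isLittleO hrec hf z)
  -- `T` is the defect divided by ε^(m+1); inversion is smooth at invertible operators, so S is
  -- smooth on the regular domain.
  refine ⟨fun p => (fderiv ℝ (nearId F m p.2) p.1).inverse (T p), fun p hp => ?_,
    fun z ε hp => ?_⟩
  · refine ContDiffWithinAt.clm_apply ?_ (hT p hp)
    exact (hp.2.contDiffAt_map_inverse.comp p
      (contDiff_fderiv_nearId F m).contDiffAt).contDiffWithinAt
  · have h := hTe (z, ε) hp
    rw [map_add, map_smul, hp.2.self_apply_inverse, ← h]
    simp

theorem hasDerivAt_nearId_comp_iff {v w : Fin n → ℝ} {z : ℝ → (Fin n → ℝ)} {t ε : ℝ}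
    (hinv : (fderiv ℝ (nearId F m ε) (z t)).IsInvertible) (hz : DifferentiableAt ℝ z t)
    (hvw : fderiv ℝ (nearId F m ε) (z t) v = w) :
    HasDerivAt (fun τ => nearId F m ε (z τ)) w t ↔ HasDerivAt z v t := by
  have hΦ : HasFDerivAt (nearId F m ε) (fderiv ℝ (nearId F m ε) (z t)) (z t) :=
    (hasFDerivAt_nearId F m ε (z t)).differentiableAt.hasFDerivAt
  refine ⟨fun h => ?_, fun h => ?_⟩
  · have h1 := h.unique (hΦ.comp_hasDerivAt t hz.hasDerivAt)
    rw [hinv.injective (hvw.trans h1)]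
    exact hz.hasDerivAt
  · rw [← hvw]
    exact hΦ.comp_hasDerivAt t h

end SmoothNormalForm

/-! ### Equivariance under the linear flow. -/

namespace SmoothNormalForm

variable {n : ℕ} {A : Matrix (Fin n) (Fin n) ℝ}

section Flow

attribute [local instance] Matrix.linftyOpNormedRing Matrix.linftyOpNormedAlgebra
  Matrix.linftyOpNormedAddCommGroup Matrix.linftyOpNormedSpace

theorem hasDerivAt_exp_smul_mulVec (A : Matrix (Fin n) (Fin n) ℝ) {u : ℝ → (Fin n → ℝ)}
    {u' : Fin n → ℝ} {s : ℝ} (hu : HasDerivAt u u' s) :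
    HasDerivAt (fun s : ℝ => NormedSpace.exp (s • A) *ᵥ u s)
      (NormedSpace.exp (s • A) *ᵥ (A *ᵥ u s + u')) s := by
  have h1 : HasDerivAt (fun s : ℝ => NormedSpace.exp (s • A)) (NormedSpace.exp (s • A) * A) s :=
    hasDerivAt_exp_smul_const A s
  let B : Matrix (Fin n) (Fin n) ℝ →L[ℝ] (Fin n → ℝ) →L[ℝ] (Fin n → ℝ) :=
    LinearMap.toContinuousLinearMap
      ((LinearMap.toContinuousLinearMap (𝕜 := ℝ) (E := Fin n → ℝ) (F' := Fin n → ℝ)).toLinearMap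
        ∘ₗ (Matrix.mulVecBilin ℝ ℝ))
  have h2 := (B.hasFDerivAt.comp_hasDerivAt s h1).clm_apply hu
  refine h2.congr_deriv ?_
  change (NormedSpace.exp (s • A) * A) *ᵥ u s + NormedSpace.exp (s • A) *ᵥ u' = _
  rw [Matrix.mulVec_add, Matrix.mulVec_mulVec]

end Flow

theorem VK.apply_exp_smul_mulVec {K : smoothFields n} (hK : K ∈ VK A) (s : ℝ) (z : Fin n → ℝ) :
    K.1 (NormedSpace.exp (s • A) *ᵥ z) = NormedSpace.exp (s • A) *ᵥ K.1 z := by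
  have hK' : ∀ x, fderiv ℝ K.1 x (A *ᵥ x) = A *ᵥ K.1 x := fun x => by
    have h := congrFun (congrArg Subtype.val (LinearMap.mem_ker.1 hK)) x
    exact sub_eq_zero.1 h
  have hcomm : ∀ s : ℝ, NormedSpace.exp (s • A) * A = A * NormedSpace.exp (s • A) := fun s =>
    (((Commute.refl A).smul_left s).exp_left).eq
  have hflow : ∀ s : ℝ, HasDerivAt (fun s : ℝ => NormedSpace.exp (s • A) *ᵥ z)
      (A *ᵥ (NormedSpace.exp (s • A) *ᵥ z)) s := fun s => by
    have h := hasDerivAt_exp_smul_mulVec A (hasDerivAt_const s z)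
    rwa [add_zero, Matrix.mulVec_mulVec, hcomm, ← Matrix.mulVec_mulVec] at h
  have hKflow : ∀ s : ℝ, HasDerivAt (fun s : ℝ => K.1 (NormedSpace.exp (s • A) *ᵥ z))
      (A *ᵥ K.1 (NormedSpace.exp (s • A) *ᵥ z)) s := fun s => by
    have h := (((contDiff_coe K).differentiable (by simp))
      (NormedSpace.exp (s • A) *ᵥ z)).hasFDerivAt.comp_hasDerivAt s (hflow s)
    rwa [hK'] at h
  -- Since s ↦ K(e^{As}z) solves u' = A u, the curve e^{-As}K(e^{As}z) is constant, with value K(z)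
  -- at s = 0.
  have hconst : ∀ s : ℝ, HasDerivAt (fun s : ℝ => NormedSpace.exp (s • (-A)) *ᵥ
      K.1 (NormedSpace.exp (s • A) *ᵥ z)) 0 s := fun s => by
    have h := hasDerivAt_exp_smul_mulVec (-A) (hKflow s)
    rwa [Matrix.neg_mulVec, neg_add_cancel, Matrix.mulVec_zero] at h
  have h := is_const_of_deriv_eq_zero (fun s => (hconst s).differentiableAt)
    (fun s => (hconst s).deriv) s 0
  simp only [zero_smul, NormedSpace.exp_zero, Matrix.one_mulVec] at h
  rw [← h, Matrix.mulVec_mulVec, smul_neg, ← Matrix.exp_add_of_commute _ _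
    (Commute.refl (s • A)).neg_right, add_neg_cancel, NormedSpace.exp_zero, Matrix.one_mulVec]

theorem IsRecursion.normalForm_exp_smul_mulVec {g F K : ℕ → smoothFields n} {m : ℕ}
    (hrec : IsRecursion A g F K m) (s ε : ℝ) (z : Fin n → ℝ) :
    normalForm A K m ε (NormedSpace.exp (s • A) *ᵥ z)
      = NormedSpace.exp (s • A) *ᵥ normalForm A K m ε z := by
  have hcomm : NormedSpace.exp (s • A) * A = A * NormedSpace.exp (s • A) :=
    (((Commute.refl A).smul_left s).exp_left).eq
  rw [normalForm, normalForm, Matrix.mulVec_add, Matrix.mulVec_sum, Matrix.mulVec_mulVec,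
    Matrix.mulVec_mulVec, hcomm]
  congr 1
  refine Finset.sum_congr rfl fun k hk => ?_
  rw [Matrix.mulVec_smul, VK.apply_exp_smul_mulVec
    (hrec k (Finset.mem_Icc.1 hk).1 (Finset.mem_Icc.1 hk).2).1]

/-! ### Existence and uniqueness for the recursion. -/

theorem contDiff_fieldR (g F K : ℕ → smoothFields n) (k : ℕ) :
    ContDiff ℝ ∞ (fieldR g F K k) := by
  have hx : ∀ j : ℕ, ContDiff ℝ ∞ (fun y : Fin n → ℝ => if j = 0 then y else (F j).1 y) := by
    intro j
    by_cases hj : j = 0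
    · simpa [hj] using contDiff_fun_id
    · simpa [hj] using contDiff_coe (F j)
  have h1 : ContDiff ℝ ∞ fun y : Fin n → ℝ =>
      coeffG g k (fun j => if j = 0 then y else (F j).1 y) :=
    (((contDiff_sum_pow_smul_comp_sum g hx (Finset.Icc 1 k)
      (Finset.range k)).iteratedDeriv_slice k).comp
        (contDiff_id.prodMk contDiff_const)).const_smul (k.factorial : ℝ)⁻¹
  exact h1.sub (ContDiff.sum fun j _ =>
    ((contDiff_coe (F j)).fderiv_right (by simp)).clm_apply (contDiff_coe (K (k - j))))

theorem fieldR_zero (g F K : ℕ → smoothFields n) (k : ℕ) : fieldR g F K k 0 = 0 := by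
  have h0 : ∀ f : smoothFields n, f.1 0 = 0 := fun f => f.2.2
  simp [fieldR, coeffG, h0]

theorem fieldR_congr (g : ℕ → smoothFields n) {F K F' K' : ℕ → smoothFields n} {k : ℕ}
    (hF : ∀ j, 1 ≤ j → j < k → F j = F' j) (hK : ∀ j, 1 ≤ j → j < k → K j = K' j) :
    fieldR g F K k = fieldR g F' K' k := by
  ext1 y
  rw [fieldR, fieldR]
  congr 1
  · have h : ∀ ε : ℝ, ∑ j ∈ Finset.range k, ε ^ j • (if j = 0 then y else (F j).1 y)
        = ∑ j ∈ Finset.range k, ε ^ j • (if j = 0 then y else (F' j).1 y) := fun ε => by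
      refine Finset.sum_congr rfl fun j hj => ?_
      by_cases hj0 : j = 0
      · simp [hj0]
      · rw [hF j (by omega) (Finset.mem_range.1 hj)]
    simp only [coeffG, h]
  · refine Finset.sum_congr rfl fun j hj => ?_
    have := Finset.mem_Icc.1 hj
    rw [hF j (by omega) (by omega), hK (k - j) (by omega) (by omega)]

/-- The decomposition is used twice: h = L_A(H) + K, then H = F + B with F ∈ V_I and B ∈ V_K. As
L_A(B) = 0, F may replace H. -/
theorem exists_isSplitting (hA : IsCompl (VI A) (VK A)) (h : smoothFields n) :
    ∃ F K : smoothFields n, IsSplitting A h.1 F K := by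
  have split : ∀ h : smoothFields n, ∃ a ∈ VI A, ∃ b ∈ VK A, a + b = h := fun h =>
    Submodule.mem_sup.1 (hA.sup_eq_top ▸ Submodule.mem_top)
  obtain ⟨_, ⟨H, rfl⟩, K, hK, rfl⟩ := split h
  obtain ⟨F, hF, B, hB, rfl⟩ := split H
  refine ⟨F, K, hK, hF, fun x => ?_⟩
  rw [map_add, LinearMap.mem_ker.1 hB, add_zero]
  rfl

/-- L_A(F - F') = K' - K lies in V_I ∩ V_K = 0. So K = K', and F - F' is in V_K as well as in V_I,
hence also zero. -/
theorem IsSplitting.unique (hA : IsCompl (VI A) (VK A)) {h : (Fin n → ℝ) → (Fin n → ℝ)}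
    {F K F' K' : smoothFields n} (h1 : IsSplitting A h F K) (h2 : IsSplitting A h F' K') :
    F = F' ∧ K = K' := by
  have disj : ∀ v, v ∈ VI A → v ∈ VK A → v = 0 := fun v hI hK =>
    Submodule.disjoint_def.1 hA.disjoint v hI hK
  have he : lieOp A F + K = lieOp A F' + K' :=
    Subtype.ext (funext fun x => (h1.2.2 x).symm.trans (h2.2.2 x))
  have he' : lieOp A (F - F') = K' - K := by
    rw [map_sub, sub_eq_sub_iff_add_eq_add, he, add_comm]
  have hz : K' - K = 0 :=
    disj _ (he' ▸ LinearMap.mem_range_self _ _) (Submodule.sub_mem _ h2.1 h1.1)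
  refine ⟨?_, (sub_eq_zero.1 hz).symm⟩
  exact sub_eq_zero.1 (disj _ (Submodule.sub_mem _ h1.2.1 h2.2.1)
    (LinearMap.mem_ker.2 (he'.trans hz)))

theorem exists_isRecursion (hA : IsCompl (VI A) (VK A)) (g : ℕ → smoothFields n) :
    ∃ F K : ℕ → smoothFields n, ∀ m, IsRecursion A g F K m := by
  choose P Q hPQ using exists_isSplitting hA
  let field (F K : ℕ → smoothFields n) (k : ℕ) : smoothFields n :=
    ⟨fieldR g F K k, contDiff_fieldR g F K k, fieldR_zero g F K k⟩
  -- The default 0 for j ≥ k is harmless, because `fieldR` at k reads only the indices 1 ≤ j < k.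
  let ext (k : ℕ) (ih : ∀ j < k, smoothFields n × smoothFields n) (j : ℕ) :
    smoothFields n × smoothFields n := if h : j < k then ih j h else 0
  let step (k : ℕ) (ih : ∀ j < k, smoothFields n × smoothFields n) :
      smoothFields n × smoothFields n :=
    let h := field (fun j => (ext k ih j).1) (fun j => (ext k ih j).2) k
    (P h, Q h)
  let sol : ℕ → smoothFields n × smoothFields n := fun k =>
    Nat.strongRec (motive := fun _ => smoothFields n × smoothFields n) step k
  have hsol : ∀ k, sol k = step k fun j _ => sol j := fun k => Nat.strongRec_eq _ _
  refine ⟨fun k => (sol k).1, fun k => (sol k).2, fun m k _ _ => ?_⟩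
  have h := hPQ (field (fun j => (ext k (fun j _ => sol j) j).1)
    (fun j => (ext k (fun j _ => sol j) j).2) k)
  have hR : fieldR g (fun k => (sol k).1) (fun k => (sol k).2) k
      = fieldR g (fun j => (ext k (fun j _ => sol j) j).1)
        (fun j => (ext k (fun j _ => sol j) j).2) k :=
    fieldR_congr g (fun j _ hj => by simp [ext, hj]) (fun j _ hj => by simp [ext, hj])
  rw [hR]
  simp only
  rw [hsol k]
  exact h

theorem IsRecursion.unique (hA : IsCompl (VI A) (VK A)) {g F K F' K' : ℕ → smoothFields n} {m : ℕ}
    (h : IsRecursion A g F K m) (h' : IsRecursion A g F' K' m) :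
    ∀ k, 1 ≤ k → k ≤ m → F k = F' k ∧ K k = K' k := by
  intro k
  induction k using Nat.strong_induction_on with
  | _ k ih =>
    intro h1 hm
    have hR := fieldR_congr g (F := F) (K := K) (F' := F') (K' := K') (k := k)
      (fun j hj hjk => (ih j hjk hj (by omega)).1) (fun j hj hjk => (ih j hjk hj (by omega)).2)
    exact (h k h1 hm).unique hA (hR ▸ h' k h1 hm)

end SmoothNormalForm

end Preliminaries

theorem theorem3p7 {n : ℕ} (A : Matrix (Fin n) (Fin n) ℝ) (g : ℕ → smoothFields n) :
    -- the recursion has exactly one solution when the two subspaces are complementary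
    (IsCompl (VI A) (VK A) →
      ∃ F K : ℕ → smoothFields n, (∀ m, IsRecursion A g F K m) ∧
        ∀ (m : ℕ) (F' K' : ℕ → smoothFields n), IsRecursion A g F' K' m →
          ∀ k, 1 ≤ k → k ≤ m → F' k = F k ∧ K' k = K k) ∧
    ∀ (m : ℕ) (F K : ℕ → smoothFields n), IsRecursion A g F K m →
      -- the transformation carries the system into its normal form plus a smooth remainder
      (∀ (U : Set ((Fin n → ℝ) × ℝ)) (f : (Fin n → ℝ) × ℝ → (Fin n → ℝ)), IsSystem A g U f →
        IsOpen (regularDomain U F m) ∧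
        (∀ C : Set (Fin n → ℝ), IsCompact C → ∃ ε₀ : ℝ, 0 < ε₀ ∧ ∀ ε : ℝ, |ε| < ε₀ →
          (∀ z ∈ C, (z, ε) ∈ regularDomain U F m) ∧ Set.InjOn (nearId F m ε) C) ∧
        ∃ S : (Fin n → ℝ) × ℝ → (Fin n → ℝ), ContDiffOn ℝ ∞ S (regularDomain U F m) ∧
          (∀ (z : Fin n → ℝ) (ε : ℝ), (z, ε) ∈ regularDomain U F m →
            fderiv ℝ (nearId F m ε) z (normalForm A K m ε z + ε ^ (m + 1) • S (z, ε))
              = f (nearId F m ε z, ε)) ∧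
          (∀ (z : ℝ → (Fin n → ℝ)) (t ε : ℝ), (z t, ε) ∈ regularDomain U F m →
            DifferentiableAt ℝ z t →
            (HasDerivAt (fun τ => nearId F m ε (z τ)) (f (nearId F m ε (z t), ε)) t ↔
              HasDerivAt z (normalForm A K m ε (z t) + ε ^ (m + 1) • S (z t, ε)) t))) ∧
      -- the normal form is equivariant under the linear flow
      (∀ (s ε : ℝ) (z : Fin n → ℝ),
        normalForm A K m ε (NormedSpace.exp (s • A) *ᵥ z)
          = NormedSpace.exp (s • A) *ᵥ normalForm A K m ε z) := by
  refine ⟨fun hA => ?_, fun m F K hrec => ⟨fun U f hf => ?_, hrec.normalForm_exp_smul_mulVec⟩⟩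
  · obtain ⟨F, K, hFK⟩ := exists_isRecursion hA g
    exact ⟨F, K, hFK, fun m F' K' h => h.unique hA (hFK m)⟩
  · refine ⟨isOpen_regularDomain hf.isOpen F m,
      fun C hC => exists_forall_mem_regularDomain_and_injOn hf.isOpen hf.mem F m hC, ?_⟩
    obtain ⟨S, hS, hSe⟩ := hrec.exists_remainder hf
    exact ⟨S, hS, hSe, fun z t ε hW hz => hasDerivAt_nearId_comp_iff hW.2 hz (hSe _ _ hW)⟩
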